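/- For $n,d\ge 1$ let $N=\binom{n+d}{d}-1$, and let $\mathbb{P}^N$ be the complex projective space whose homogeneous coordinates $m_{i_1\cdots i_n}$ are indexed by the exponents $i_1,\dots,i_n\ge 0$ with $i_1+\cdots+i_n\le d$. For $k\ge 1$ let ${\rm Sec}_k(\mathcal{G}_{n,d})\subset\mathbb{P}^N$ be the Zariski closure of the set of points whose coordinates are given by the formal identity $$\sum_{i_1,\dots,i_n\ge 0}\frac{m_{i_1\cdots i_n}}{i_1!\cdots i_n!}\,t_1^{i_1}\cdots t_n^{i_n}\;=\;\sum_{\ell=1}^k\lambda_\ell\,\exp\Bigl(\sum_{i=1}^n t_i\mu_{\ell i}\Bigr)\exp\Bigl(\tfrac12\sum_{i,j=1}^n\sigma_{\ell ij}t_it_j\Bigr),$$ where $\lambda_\ell,\mu_{\ell i},\sigma_{\ell ij}=\sigma_{\ell ji}$ range over all complex numbers with $\lambda_1+\cdots+\lambda_k=1$. The Gaussian moment variety is $\mathcal{G}_{n,d}={\rm Sec}_1(\mathcal{G}_{n,d})$. For $d\ge 2$, it is called $k$-defective if the dimension of ${\rm Sec}_k(\mathcal{G}_{n,d})$ is smaller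 than expected, that is, if $$\dim {\rm Sec}_k(\mathcal{G}_{n,d})\;<\;\min\Bigl\{N,\ \tfrac12kn(n+3)+k-1\Bigr\}.$$ **Corollary.** Let $k\ge 2$ and $n\ge 3k-3$. Then $\mathcal{G}_{n,3}$ is $k$-defective. -/

import Mathlib

noncomputable section

/-! ### Complex projective space with its Zariski topology -/

/-- Complex projective space with homogeneous coordinates indexed by `ι`. -/
def ProjSpace (ι : Type) : Type := Projectivization ℂ (ι → ℂ)

namespace ProjSpace

variable {ι : Type}

/-- The point of projective space with homogeneous coordinate vector `v ≠ 0`. -/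
def mk (v : ι → ℂ) (hv : v ≠ 0) : ProjSpace ι := Projectivization.mk ℂ v hv

/-- A vector of homogeneous coordinates of a point. -/
def coords (x : ProjSpace ι) : ι → ℂ := Projectivization.rep (K := ℂ) (V := ι → ℂ) x

/-- The common zero locus in projective space of a set of polynomials. It is used for homogeneous
polynomials only, for which it does not depend on the choice of homogeneous coordinates. -/
def zeroLocus (S : Set (MvPolynomial ι ℂ)) : Set (ProjSpace ι) :=
  {x | ∀ p ∈ S, MvPolynomial.eval x.coords p = 0}

/-- Projective algebraic sets: zero loci of sets of homogeneous polynomials. -/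
def IsAlgebraic (Z : Set (ProjSpace ι)) : Prop :=
  ∃ S : Set (MvPolynomial ι ℂ), (∀ p ∈ S, ∃ m : ℕ, p.IsHomogeneous m) ∧ Z = zeroLocus S

/-- The vanishing of a homogeneous polynomial can be tested on any homogeneous coordinates. -/
theorem eval_coords_mk_eq_zero_iff (v : ι → ℂ) (hv : v ≠ 0) {p : MvPolynomial ι ℂ} {m : ℕ}
    (hp : p.IsHomogeneous m) :
    MvPolynomial.eval (mk v hv).coords p = 0 ↔ MvPolynomial.eval v p = 0 := by
  obtain ⟨a, ha⟩ := Projectivization.exists_smul_eq_mk_rep ℂ v hv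
  have h : (mk v hv).coords = (a : ℂ) • v := ha.symm
  have h2 : MvPolynomial.eval ((a : ℂ) • v) p = (a : ℂ) ^ m * MvPolynomial.eval v p := by
    rw [MvPolynomial.eval_eq, MvPolynomial.eval_eq, Finset.mul_sum]
    refine Finset.sum_congr rfl fun e he => ?_
    have hdeg : ∑ i ∈ e.support, e i = m := by
      have h3 : Finsupp.weight 1 e = m := hp (MvPolynomial.mem_support_iff.1 he)
      have h4 : e.degree = Finsupp.weight 1 e :=
        DFunLike.congr_fun (Finsupp.degree_eq_weight_one (R := ℕ)) e
      exact h4.trans h3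
    simp only [Pi.smul_apply, smul_eq_mul, mul_pow, Finset.prod_mul_distrib,
      Finset.prod_pow_eq_pow_sum, hdeg]
    ring
  rw [h, h2, mul_eq_zero]
  simp

theorem isAlgebraic_empty : IsAlgebraic (∅ : Set (ProjSpace ι)) := by
  refine ⟨{1}, ?_, ?_⟩
  · rintro p rfl
    exact ⟨0, MvPolynomial.isHomogeneous_one ι ℂ⟩
  · ext x
    simp [zeroLocus]

theorem isAlgebraic_sInter (A : Set (Set (ProjSpace ι))) (hA : ∀ Z ∈ A, IsAlgebraic Z) :
    IsAlgebraic (⋂₀ A) := by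
  refine ⟨{p | (∃ m : ℕ, p.IsHomogeneous m) ∧
    ∃ Z ∈ A, ∀ x ∈ Z, MvPolynomial.eval x.coords p = 0}, fun p hp => hp.1, ?_⟩
  ext x
  constructor
  · rintro hx p ⟨-, Z, hZ, hp⟩
    exact hp x (hx Z hZ)
  · intro hx Z hZ
    obtain ⟨S, hS, rfl⟩ := hA Z hZ
    exact fun p hp => hx p ⟨hS p hp, _, hZ, fun y hy => hy p hp⟩

theorem isAlgebraic_union (Z W : Set (ProjSpace ι)) (hZ : IsAlgebraic Z) (hW : IsAlgebraic W) :
    IsAlgebraic (Z ∪ W) := by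
  obtain ⟨S, hS, rfl⟩ := hZ
  obtain ⟨T, hT, rfl⟩ := hW
  refine ⟨{r | ∃ p ∈ S, ∃ q ∈ T, r = p * q}, ?_, ?_⟩
  · rintro r ⟨p, hp, q, hq, rfl⟩
    obtain ⟨a, ha⟩ := hS p hp
    obtain ⟨b, hb⟩ := hT q hq
    exact ⟨a + b, ha.mul hb⟩
  · ext x
    constructor
    · rintro (hx | hx) r ⟨p, hp, q, hq, rfl⟩
      · rw [map_mul, hx p hp, zero_mul]
      · rw [map_mul, hx q hq, mul_zero]
    · intro hx
      by_contra hcon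
      rw [Set.mem_union, not_or] at hcon
      obtain ⟨h1, h2⟩ := hcon
      simp only [zeroLocus, Set.mem_ofPred_eq, not_forall] at h1 h2
      obtain ⟨p, hp, hp0⟩ := h1
      obtain ⟨q, hq, hq0⟩ := h2
      have := hx (p * q) ⟨p, hp, q, hq, rfl⟩
      rw [map_mul] at this
      exact (mul_ne_zero hp0 hq0) this

/-- The Zariski topology: the closed sets are the projective algebraic sets. -/
instance : TopologicalSpace (ProjSpace ι) :=
  TopologicalSpace.ofClosed {Z | IsAlgebraic Z} isAlgebraic_empty isAlgebraic_sInter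
    (fun Z hZ W hW => isAlgebraic_union Z W hZ hW)

/-- The dimension of a subset of projective space: the supremum of the lengths of chains of
irreducible closed subsets, in the Zariski topology induced on the subset. -/
def dim (Z : Set (ProjSpace ι)) : WithBot ℕ∞ := topologicalKrullDim Z

end ProjSpace

/-! ### Gaussian moment varieties and their secant varieties -/

namespace GaussianMoments

/-- The exponents `(i₁, …, iₙ)` with `i₁ + ⋯ + iₙ ≤ d`, which index the moments
of order at most `d`; there are `(n + d).choose d` of them. -/
abbrev MomentIndex (n d : ℕ) : Type := {i : Fin n →₀ ℕ // i.degree ≤ d}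

/-- The formal power series `exp(∑ tᵢ μᵢ) * exp(1/2 * ∑ σᵢⱼ tᵢ tⱼ)` in `t₁, …, tₙ`, the moment
generating function of the Gaussian distribution with mean `μ` and covariance matrix `Σ = (σᵢⱼ)`. -/
def gaussianSeries {n : ℕ} (μ : Fin n → ℂ) (σ : Matrix (Fin n) (Fin n) ℂ) :
    MvPowerSeries (Fin n) ℂ :=
  (PowerSeries.exp ℂ).subst (∑ i, MvPowerSeries.C (μ i) * MvPowerSeries.X i) *
  (PowerSeries.exp ℂ).subst
    (MvPowerSeries.C (1 / 2 : ℂ) *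
      ∑ i, ∑ j, MvPowerSeries.C (σ i j) * MvPowerSeries.X i * MvPowerSeries.X j)

/-- The moment `m_{i₁…iₙ}` of the mixture of `k` Gaussians with mixture parameters `w`, means `μ`
and covariance matrices `σ`: it is `i₁! ⋯ iₙ!` times the coefficient of `t₁^{i₁} ⋯ tₙ^{iₙ}` in
`∑ ℓ, w ℓ * exp(∑ tᵢ μ_{ℓ i}) * exp(1/2 * ∑ σ_{ℓ i j} tᵢ tⱼ)`. -/
def mixtureMoment {n k : ℕ} (w : Fin k → ℂ) (μ : Fin k → Fin n → ℂ)
    (σ : Fin k → Matrix (Fin n) (Fin n) ℂ) (i : Fin n →₀ ℕ) : ℂ :=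
  ((∏ j, (i j).factorial : ℕ) : ℂ) *
    MvPowerSeries.coeff i (∑ l, MvPowerSeries.C (w l) * gaussianSeries (μ l) (σ l))

/-- The vector of all moments of order at most `d` of a mixture of `k` Gaussians. -/
def momentVector {n k : ℕ} (d : ℕ) (w : Fin k → ℂ) (μ : Fin k → Fin n → ℂ)
    (σ : Fin k → Matrix (Fin n) (Fin n) ℂ) : MomentIndex n d → ℂ :=
  fun i => mixtureMoment w μ σ i.1

theorem constantCoeff_gaussianSeries {n : ℕ} (μ : Fin n → ℂ) (σ : Matrix (Fin n) (Fin n) ℂ) :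
    MvPowerSeries.constantCoeff (gaussianSeries μ σ) = 1 := by
  have key : ∀ a : MvPowerSeries (Fin n) ℂ, MvPowerSeries.constantCoeff a = 0 →
      MvPowerSeries.constantCoeff ((PowerSeries.exp ℂ).subst a) = 1 := by
    intro a ha
    rw [PowerSeries.constantCoeff_subst (PowerSeries.HasSubst.of_constantCoeff_zero ha),
      finsum_eq_single _ 0]
    · simp
    · intro m hm
      simp [ha, hm]
  rw [gaussianSeries, map_mul, key _ (by simp), key _ (by simp), one_mul]

/-- The moment of order `0` is the sum of the mixture parameters. -/
theorem mixtureMoment_zero {n k : ℕ} (w : Fin k → ℂ) (μ : Fin k → Fin n → ℂ)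
    (σ : Fin k → Matrix (Fin n) (Fin n) ℂ) : mixtureMoment w μ σ 0 = ∑ l, w l := by
  simp [mixtureMoment, constantCoeff_gaussianSeries]

theorem momentVector_ne_zero {n k : ℕ} (d : ℕ) (w : Fin k → ℂ) (hw : ∑ l, w l = 1)
    (μ : Fin k → Fin n → ℂ) (σ : Fin k → Matrix (Fin n) (Fin n) ℂ) :
    momentVector d w μ σ ≠ 0 := by
  intro h
  have h0 : momentVector d w μ σ ⟨0, by simp⟩ = 0 := by rw [h]; rfl
  have h1 : mixtureMoment w μ σ 0 = 0 := h0
  rw [mixtureMoment_zero, hw] at h1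
  exact one_ne_zero h1

/-- The image in projective space of the parametrization by mixtures of `k` Gaussians: the mixture
parameters sum to `1`, so it lies in the chart where the moment of order `0` equals `1`. The
parameters are arbitrary complex numbers, with symmetric covariance matrices. -/
def mixtureImage (k n d : ℕ) : Set (ProjSpace (MomentIndex n d)) :=
  {x | ∃ (w : Fin k → ℂ) (hw : ∑ l, w l = 1) (μ : Fin k → Fin n → ℂ)
    (σ : Fin k → Matrix (Fin n) (Fin n) ℂ), (∀ l, (σ l).IsSymm) ∧
    x = ProjSpace.mk (momentVector d w μ σ) (momentVector_ne_zero d w hw μ σ)}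

/-- The `k`th secant variety `Sec_k(G_{n,d})` of the Gaussian moment variety: the Zariski closure
of the image of the parametrization by mixtures of `k` Gaussians. The Gaussian moment variety
`G_{n,d}` itself is the case `k = 1`. -/
def Sec (k n d : ℕ) : Set (ProjSpace (MomentIndex n d)) := closure (mixtureImage k n d)

/-- The expected dimension of `Sec_k(G_{n,d})` for `k ≥ 1` and `d ≥ 2`: the smaller of the dimension
`N = (n + d).choose d - 1` of the ambient space and the number `k * n(n+3)/2 + k - 1` of model
parameters. None of the subtractions truncates, and `n * (n + 3)` is even. -/
def expectedDim (k n d : ℕ) : ℕ :=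
  min ((n + d).choose d - 1) (k * (n * (n + 3) / 2) + k - 1)

/-- `G_{n,d}` is `k`-defective if the dimension of its `k`th secant variety is smaller than
expected. -/
def IsDefective (k n d : ℕ) : Prop :=
  ProjSpace.dim (Sec k n d) < ((expectedDim k n d : ℕ) : WithBot ℕ∞)

end GaussianMoments

end

/-!
Write `k = r + 1`, `n = r + m`, and let `M₁`, `M₂`, `M₃` be the moments of order one, two and three
of a mixture of Gaussians with weights `w l`, means `μ l` and covariances `σ l`, seen as symmetric
multilinear forms. The third cumulant `M₃ - 3 M₂ M₁ + 2 M₁³` (with the product symmetrized) is a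
combination of terms which each contain a factor `μ l - M₁`, so it vanishes on the linear space on
which all means take the same value (`triForm_thirdMoment_of_dotProduct_eq`). For generic means this
space has codimension `r`, and it is the graph of an `r × m` matrix `A`. Expanding the cumulant on
the graph expresses the `(m + 2).choose 3` moments of order three in the last `m` variables
rationally through the other moments and the `r * m` entries of `A` (`thirdMoment_natAdd_mem`).

Hence the field generated by the coordinates of the generic point of the affine cone over the
mixtures has transcendence degree at most the number of the other moments plus `r * m`
(`exists_generators_genericMoment`), and a count (`card_freeExponents_le`, `le_expectedDim`) bounds
this by the expected dimension. The dimension of the closure is one less than that of its cone.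

The passage from transcendence degree to topological dimension is `ProjSpace.dim_closure_le`:
a chain of irreducible closed subsets gives a chain of homogeneous prime ideals, to which the ideal
of the vertex of the cone is added; the Krull dimension of the coordinate ring of the cone is
bounded by its transcendence degree through Noether normalization. The moments themselves are
computed by differentiating the series: `∂ₐ exp(L + Q) = (μₐ + ∑ σₐᵦ tᵦ) exp(L + Q)`.
-/

noncomputable section

namespace ProjSpace

/-! ### Vanishing ideals in projective space -/

variable {ι : Type}

theorem coords_ne_zero (x : ProjSpace ι) : x.coords ≠ 0 :=
  Projectivization.rep_nonzero x

theorem mk_coords (x : ProjSpace ι) : mk x.coords x.coords_ne_zero = x :=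
  Projectivization.mk_rep x

theorem mk_smul (v : ι → ℂ) (hv : v ≠ 0) (c : ℂ) (hcv : c • v ≠ 0) :
    mk (c • v) hcv = mk v hv :=
  (Projectivization.mk_eq_mk_iff' ℂ _ _ _ _).2 ⟨c, rfl⟩

/-- The ideal of all polynomials, homogeneous or not, that vanish on the punctured affine cone
over a subset of projective space. -/
def vanishingIdeal (Z : Set (ProjSpace ι)) : Ideal (MvPolynomial ι ℂ) where
  carrier := {f | ∀ v hv, mk v hv ∈ Z → MvPolynomial.eval v f = 0}
  add_mem' := fun {f g} hf hg v hv h => by rw [map_add, hf v hv h, hg v hv h, add_zero]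
  zero_mem' := fun v _ _ => map_zero _
  smul_mem' := fun c f hf v hv h => by rw [smul_eq_mul, map_mul, hf v hv h, mul_zero]

theorem vanishingIdeal_anti {Z W : Set (ProjSpace ι)} (h : Z ⊆ W) :
    vanishingIdeal W ≤ vanishingIdeal Z :=
  fun _ hf v hv hvZ => hf v hv (h hvZ)

theorem eval_smul_of_isHomogeneous {f : MvPolynomial ι ℂ} {m : ℕ} (hf : f.IsHomogeneous m)
    (c : ℂ) (v : ι → ℂ) :
    MvPolynomial.eval (c • v) f = c ^ m * MvPolynomial.eval v f := by
  rw [MvPolynomial.eval_eq, MvPolynomial.eval_eq, Finset.mul_sum]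
  refine Finset.sum_congr rfl fun e he => ?_
  have hdeg : ∑ i ∈ e.support, e i = m := by
    have h3 : Finsupp.weight 1 e = m := hf (MvPolynomial.mem_support_iff.1 he)
    have h4 : e.degree = Finsupp.weight 1 e :=
      DFunLike.congr_fun (Finsupp.degree_eq_weight_one (R := ℕ)) e
    exact h4.trans h3
  simp only [Pi.smul_apply, smul_eq_mul, mul_pow, Finset.prod_mul_distrib,
    Finset.prod_pow_eq_pow_sum, hdeg]
  ring

/-- A polynomial vanishing on the punctured line through `v` has all its homogeneous components
vanishing at `v`, because `c ↦ f (c • v)` is a polynomial in `c` with infinitely many zeros. -/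
theorem homogeneousComponent_mem_vanishingIdeal {Z : Set (ProjSpace ι)} {f : MvPolynomial ι ℂ}
    (hf : f ∈ vanishingIdeal Z) (m : ℕ) :
    MvPolynomial.homogeneousComponent m f ∈ vanishingIdeal Z := by
  intro v hv hvZ
  let q : Polynomial ℂ := ∑ i ∈ Finset.range (f.totalDegree + 1),
    Polynomial.monomial i (MvPolynomial.eval v (MvPolynomial.homogeneousComponent i f))
  have hq : ∀ c : ℂ, q.eval c = MvPolynomial.eval (c • v) f := by
    intro c
    conv_rhs => rw [← MvPolynomial.sum_homogeneousComponent f]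
    rw [map_sum, Polynomial.eval_finsetSum]
    refine Finset.sum_congr rfl fun i _ => ?_
    rw [eval_smul_of_isHomogeneous (MvPolynomial.homogeneousComponent_isHomogeneous i f),
      Polynomial.eval_monomial, mul_comm]
  have hq0 : q = 0 := by
    refine Polynomial.eq_zero_of_infinite_isRoot q ?_
    refine Set.Infinite.mono ?_ (Set.finite_singleton (0 : ℂ)).infinite_compl
    intro c hc
    have hc : c ≠ 0 := hc
    have hcv : c • v ≠ 0 := smul_ne_zero hc hv
    change q.eval c = 0
    rw [hq]
    exact hf _ hcv (by rwa [mk_smul v hv c hcv])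
  by_cases hm : m ≤ f.totalDegree
  · have := congrArg (fun r => Polynomial.coeff r m) hq0
    simpa [q, Polynomial.finsetSum_coeff, Polynomial.coeff_monomial, Nat.lt_succ_iff, hm]
      using this
  · rw [MvPolynomial.homogeneousComponent_eq_zero _ _ (not_le.1 hm), map_zero]

attribute [local instance] MvPolynomial.gradedAlgebra

theorem isHomogeneous_vanishingIdeal (Z : Set (ProjSpace ι)) :
    (vanishingIdeal Z).IsHomogeneous (MvPolynomial.homogeneousSubmodule ι ℂ) := by
  intro m f hf
  exact (MvPolynomial.decomposition.decompose'_apply f m) ▸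
    homogeneousComponent_mem_vanishingIdeal hf m

theorem isClosed_iff {Z : Set (ProjSpace ι)} : IsClosed Z ↔ IsAlgebraic Z := by
  rw [← isOpen_compl_iff]
  change Zᶜᶜ ∈ {Z | IsAlgebraic Z} ↔ _
  rw [compl_compl, Set.mem_ofPred_eq]

theorem isClosed_zeroLocus {S : Set (MvPolynomial ι ℂ)}
    (hS : ∀ p ∈ S, ∃ m : ℕ, p.IsHomogeneous m) : IsClosed (zeroLocus S) :=
  isClosed_iff.2 ⟨S, hS, rfl⟩

/-- A homogeneous polynomial that vanishes on a set also vanishes on its Zariski closure. -/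
theorem vanishingIdeal_closure (Z : Set (ProjSpace ι)) :
    vanishingIdeal (closure Z) = vanishingIdeal Z := by
  refine le_antisymm (vanishingIdeal_anti subset_closure) fun f hf => ?_
  rw [MvPolynomial.mem_iff_homogeneousComponent_mem (isHomogeneous_vanishingIdeal _)]
  intro m v hv hvZ
  have hhom := MvPolynomial.homogeneousComponent_isHomogeneous m f
  have hsub : closure Z ⊆ zeroLocus {MvPolynomial.homogeneousComponent m f} := by
    refine closure_minimal ?_ (isClosed_zeroLocus ?_)
    · rintro x hx p rfl
      exact homogeneousComponent_mem_vanishingIdeal hf m _ x.coords_ne_zero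
        (by rwa [mk_coords])
    · rintro p rfl
      exact ⟨m, hhom⟩
  exact (eval_coords_mk_eq_zero_iff v hv hhom).1 (hsub hvZ _ rfl)

/-- A closed set is determined by its vanishing ideal. -/
theorem subset_of_vanishingIdeal_le {Z W : Set (ProjSpace ι)} (hW : IsClosed W)
    (h : vanishingIdeal W ≤ vanishingIdeal Z) : Z ⊆ W := by
  obtain ⟨S, hS, rfl⟩ := isClosed_iff.1 hW
  intro x hx p hp
  obtain ⟨m, hm⟩ := hS p hp
  refine h (fun v hv hv' => ?_) x.coords x.coords_ne_zero (by rwa [mk_coords])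
  exact (eval_coords_mk_eq_zero_iff v hv hm).1 (hv' p hp)

theorem isPrime_vanishingIdeal {Z : Set (ProjSpace ι)} (hZ : IsIrreducible Z) :
    (vanishingIdeal Z).IsPrime := by
  refine (isHomogeneous_vanishingIdeal Z).isPrime_of_homogeneous_mem_or_mem ?_ ?_
  · obtain ⟨x, hx⟩ := hZ.nonempty
    intro h
    have h1 : (1 : MvPolynomial ι ℂ) ∈ vanishingIdeal Z := h ▸ Submodule.mem_top
    simpa using h1 x.coords x.coords_ne_zero (by rwa [mk_coords])
  · rintro f g ⟨a, ha⟩ ⟨b, hb⟩ hfg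
    have ha' : f.IsHomogeneous a := ha
    have hb' : g.IsHomogeneous b := hb
    have key : Z ⊆ zeroLocus {f} ∪ zeroLocus {g} := by
      intro x hx
      have := hfg x.coords x.coords_ne_zero (by rwa [mk_coords])
      rw [map_mul, mul_eq_zero] at this
      exact this.imp (fun h p hp => by rw [Set.mem_singleton_iff.1 hp, h])
        (fun h p hp => by rw [Set.mem_singleton_iff.1 hp, h])
    have hcl : ∀ {p : MvPolynomial ι ℂ} {m : ℕ}, p.IsHomogeneous m →
        IsClosed (zeroLocus {p}) := fun {p m} hp =>
      isClosed_zeroLocus (by rintro _ rfl; exact ⟨m, hp⟩)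
    refine ((isPreirreducible_iff_isClosed_union_isClosed.1 hZ.isPreirreducible) _ _
      (hcl ha') (hcl hb') key).imp ?_ ?_
    · exact fun h v hv hvZ => (eval_coords_mk_eq_zero_iff v hv ha').1 (h hvZ _ rfl)
    · exact fun h v hv hvZ => (eval_coords_mk_eq_zero_iff v hv hb').1 (h hvZ _ rfl)

/-- The ideal of the vertex of the affine cone, that is, of the polynomials without constant
term, strictly contains every vanishing ideal of a nonempty set. -/
theorem vanishingIdeal_lt_ker_eval_zero {Z : Set (ProjSpace ι)} (hZ : Z.Nonempty) :
    vanishingIdeal Z < RingHom.ker (MvPolynomial.eval (0 : ι → ℂ)) := by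
  obtain ⟨x, hx⟩ := hZ
  refine lt_of_le_not_ge (fun f hf => ?_) fun h => ?_
  · have h0 := homogeneousComponent_mem_vanishingIdeal hf 0 x.coords x.coords_ne_zero
      (by rwa [mk_coords])
    rw [MvPolynomial.homogeneousComponent_zero, MvPolynomial.eval_C] at h0
    rwa [RingHom.mem_ker, MvPolynomial.eval_zero, MvPolynomial.constantCoeff_eq]
  · obtain ⟨i, hi⟩ := Function.ne_iff.1 x.coords_ne_zero
    refine hi ?_
    have hX : (MvPolynomial.X i : MvPolynomial ι ℂ) ∈ vanishingIdeal Z :=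
      h (by simp [RingHom.mem_ker])
    simpa using hX x.coords x.coords_ne_zero (by rwa [mk_coords])

/-- The projective dimension is one less than the dimension of the affine cone: a chain of
irreducible closed subsets gives a chain of homogeneous primes, and the ideal of the vertex of the
cone makes it longer by one. -/
theorem dim_add_one_le {Z : Set (ProjSpace ι)} (hZ : IsClosed Z) (hne : Z.Nonempty)
    {J : Ideal (MvPolynomial ι ℂ)} (hJ : J ≤ vanishingIdeal Z) :
    dim Z + 1 ≤ ringKrullDim (MvPolynomial ι ℂ ⧸ J) := by
  have hsub : ∀ T : TopologicalSpace.IrreducibleCloseds Z, Subtype.val '' (T : Set Z) ⊆ Z :=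
    fun T => by rintro _ ⟨y, -, rfl⟩; exact y.2
  have hcl : ∀ T : TopologicalSpace.IrreducibleCloseds Z,
      IsClosed (Subtype.val '' (T : Set Z)) :=
    fun T => hZ.isClosedMap_subtype_val _ T.isClosed
  have hirr : ∀ T : TopologicalSpace.IrreducibleCloseds Z,
      IsIrreducible (Subtype.val '' (T : Set Z)) :=
    fun T => T.isIrreducible.image _ continuous_subtype_val.continuousOn
  let F : TopologicalSpace.IrreducibleCloseds Z → PrimeSpectrum.zeroLocus
      (J : Set (MvPolynomial ι ℂ)) :=
    fun T => ⟨⟨vanishingIdeal (Subtype.val '' (T : Set Z)), isPrime_vanishingIdeal (hirr T)⟩,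
      hJ.trans (vanishingIdeal_anti (hsub T))⟩
  let V : PrimeSpectrum.zeroLocus (J : Set (MvPolynomial ι ℂ)) :=
    ⟨⟨RingHom.ker (MvPolynomial.eval (0 : ι → ℂ)), RingHom.ker_isPrime _⟩,
      hJ.trans (vanishingIdeal_lt_ker_eval_zero hne).le⟩
  have hFV : ∀ T, F T < V := fun T =>
    vanishingIdeal_lt_ker_eval_zero (hirr T).nonempty
  have hF : ∀ T U, T < U → F U < F T := by
    intro T U hTU
    refine lt_of_le_not_ge (vanishingIdeal_anti (Set.image_mono hTU.le)) fun h => ?_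
    have := subset_of_vanishingIdeal_le (hcl T) h
    exact hTU.not_ge ((Set.image_subset_image_iff Subtype.val_injective).1 this)
  have : Nonempty (TopologicalSpace.IrreducibleCloseds Z) := by
    obtain ⟨x, hx⟩ := hne
    exact ⟨⟨closure {⟨x, hx⟩}, isIrreducible_singleton.closure, isClosed_closure⟩⟩
  rw [dim, topologicalKrullDim, ← Order.krullDim_withBot, ringKrullDim_quotient,
    ← Order.krullDim_orderDual (α := PrimeSpectrum.zeroLocus (J : Set (MvPolynomial ι ℂ)))]
  refine Order.krullDim_le_of_strictMono
    (fun T => WithBot.recBotCoe (OrderDual.toDual V) (fun T => OrderDual.toDual (F T)) T) ?_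
  intro T U hTU
  induction U with
  | bot => exact absurd hTU not_lt_bot
  | coe U =>
    induction T with
    | bot => exact hFV U
    | coe T => exact hF T U (WithBot.coe_lt_coe.1 hTU)

end ProjSpace

/-! ### Krull dimension and transcendence degree -/

/-- The Krull dimension of a finitely generated algebra over a field is bounded by its
transcendence degree, by Noether normalization. -/
theorem ringKrullDim_le_of_trdeg_le {k A : Type} [Field k] [CommRing A] [Nontrivial A]
    [Algebra k A] [Algebra.FiniteType k A] {n : ℕ} (h : Algebra.trdeg k A ≤ n) :
    ringKrullDim A ≤ n := by
  obtain ⟨s, g, hg, hint⟩ := exists_integral_inj_algHom_of_fg k A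
  have hs : s ≤ n := by
    have h1 := trdeg_le_of_injective g hg
    rw [MvPolynomial.trdeg_of_isDomain] at h1
    simp only [Cardinal.mk_fin, Cardinal.lift_natCast] at h1
    exact_mod_cast h1.trans h
  have hdim : ringKrullDim A ≤ ringKrullDim (MvPolynomial (Fin s) k) := by
    algebraize [g.toRingHom]
    have : Algebra.IsIntegral (MvPolynomial (Fin s) k) A := ⟨hint⟩
    refine Order.krullDim_le_of_strictMono
      (PrimeSpectrum.comap (algebraMap (MvPolynomial (Fin s) k) A)) fun P Q hPQ => ?_
    have : P.asIdeal < Q.asIdeal := hPQ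
    exact Ideal.IsIntegral.comap_lt_comap this
  refine hdim.trans ?_
  rw [MvPolynomial.ringKrullDim_of_isNoetherianRing, ringKrullDim_eq_zero_of_field, zero_add]
  simpa using hs

open IntermediateField.algebraAdjoinAdjoin in
/-- A field generated by finitely many elements is algebraic over the ring they generate, which is
a quotient of a polynomial ring. -/
theorem trdeg_adjoin_le {k K : Type} [Field k] [Field K] [Algebra k K] (S : Finset K) :
    Algebra.trdeg k (IntermediateField.adjoin k (S : Set K)) ≤ S.card := by
  have hAL := trdeg_add_eq k (Algebra.adjoin k (S : Set K))
    (A := IntermediateField.adjoin k (S : Set K))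
  have h0 : Algebra.trdeg (Algebra.adjoin k (S : Set K))
      (IntermediateField.adjoin k (S : Set K)) = 0 := trdeg_eq_zero_iff.2 inferInstance
  rw [h0, add_zero] at hAL
  rw [← hAL]
  have hsurj : Function.Surjective
      ((MvPolynomial.aeval (R := k) (Subtype.val : S → K)).rangeRestrict) :=
    AlgHom.rangeRestrict_surjective _
  have h2 := trdeg_le_of_surjective _ hsurj
  have hrange : (MvPolynomial.aeval (R := k) (Subtype.val : S → K)).range =
      Algebra.adjoin k (S : Set K) := by
    rw [← Algebra.adjoin_range_eq_range_aeval]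
    exact congrArg _ Subtype.range_coe
  rw [MvPolynomial.trdeg_of_isDomain, (Subalgebra.equivOfEq _ _ hrange).trdeg_eq] at h2
  simpa using h2

namespace ProjSpace

variable {ι : Type}

/-- If a set `W` of points is parametrized through a generic point `x` of its affine cone, whose
coordinates generate a field of transcendence degree at most `p + 1`, then the Zariski closure
of `W` has dimension at most `p`. That `x` is generic is expressed by the hypothesis that every
polynomial relation between its coordinates holds on the cone over `W`. -/
theorem dim_closure_le [Finite ι] {W : Set (ProjSpace ι)} (hW : W.Nonempty)
    {K : Type} [Field K] [Algebra ℂ K]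
    (x : ι → K) (hx : ∀ f, MvPolynomial.aeval x f = 0 → f ∈ vanishingIdeal W) (S : Finset K)
    (hS : ∀ i, x i ∈ IntermediateField.adjoin ℂ (S : Set K)) {p : ℕ} (hp : S.card ≤ p + 1) :
    dim (closure W) ≤ (p : WithBot ℕ∞) := by
  let L := IntermediateField.adjoin ℂ (S : Set K)
  let y : ι → L := fun i => ⟨x i, hS i⟩
  let φ : MvPolynomial ι ℂ →ₐ[ℂ] L := MvPolynomial.aeval y
  have hφ : RingHom.ker φ ≤ vanishingIdeal (closure W) := by
    rw [vanishingIdeal_closure]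
    intro f hf
    refine hx f ?_
    have h1 : MvPolynomial.aeval y f = 0 := hf
    have h2 := MvPolynomial.aeval_algebraMap_apply K y f
    rw [h1, map_zero] at h2
    exact h2
  have : (RingHom.ker φ).IsPrime := RingHom.ker_isPrime _
  have h1 := dim_add_one_le isClosed_closure hW.closure hφ
  have h2 : ringKrullDim (MvPolynomial ι ℂ ⧸ RingHom.ker φ) ≤ (p + 1 : ℕ) := by
    refine ringKrullDim_le_of_trdeg_le (k := ℂ) ?_
    refine (trdeg_le_of_injective (Ideal.kerLiftAlg φ)
      (Ideal.kerLiftAlg_injective φ)).trans ((trdeg_adjoin_le S).trans ?_)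
    exact_mod_cast hp
  have h3 := h1.trans h2
  generalize dim (closure W) = d at h3
  induction d with
  | bot => exact bot_le
  | coe d =>
    have h4 : d + 1 ≤ ((p : ℕ∞) + 1) := by exact_mod_cast h3
    exact_mod_cast (ENat.add_le_add_iff_right ENat.one_ne_top).1 h4

end ProjSpace

namespace GaussianMoments

/-! ### The moments of order at most three -/

/-- The truncation after `N` terms of the exponential of a power series. -/
def expTrunc {τ : Type} (u : MvPowerSeries τ ℂ) (N : ℕ) : MvPowerSeries τ ℂ :=
  ∑ d ∈ Finset.range N, ((d.factorial : ℂ)⁻¹) • u ^ d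

theorem coeff_pow_eq_zero {τ : Type} {u : MvPowerSeries τ ℂ}
    (hu : MvPowerSeries.constantCoeff u = 0) {e : τ →₀ ℕ} {d : ℕ} (h : e.degree < d) :
    MvPowerSeries.coeff e (u ^ d) = 0 :=
  MvPowerSeries.coeff_eq_zero_of_constantCoeff_nilpotent (m := 1) (by simpa using hu) (by omega)

theorem coeff_exp_subst {τ : Type} {u : MvPowerSeries τ ℂ}
    (hu : MvPowerSeries.constantCoeff u = 0) {e : τ →₀ ℕ} {N : ℕ} (h : e.degree < N) :
    MvPowerSeries.coeff e ((PowerSeries.exp ℂ).subst u) =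
      MvPowerSeries.coeff e (expTrunc u N) := by
  rw [PowerSeries.coeff_subst (PowerSeries.HasSubst.of_constantCoeff_zero hu),
    finsum_eq_sum_of_support_subset (s := Finset.range N)]
  · simp [expTrunc, PowerSeries.coeff_exp]
  · intro d hd
    by_contra hcon
    refine hd ?_
    beta_reduce
    rw [coeff_pow_eq_zero hu (by simp at hcon; omega), smul_zero]

theorem pderiv_expTrunc {τ : Type} (u : MvPowerSeries τ ℂ) (N : ℕ) (a : τ) :
    MvPowerSeries.pderiv ℂ a (expTrunc u (N + 1)) =
      expTrunc u N * MvPowerSeries.pderiv ℂ a u := by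
  rw [expTrunc, Finset.sum_range_succ', map_add, map_sum, expTrunc, Finset.sum_mul]
  rw [pow_zero, Derivation.map_smul, MvPowerSeries.pderiv_one, smul_zero, add_zero]
  refine Finset.sum_congr rfl fun d _ => ?_
  rw [Derivation.map_smul, MvPowerSeries.pderiv_pow, Nat.add_sub_cancel, mul_assoc, smul_mul_assoc,
    ← nsmul_eq_mul, ← Nat.cast_smul_eq_nsmul ℂ, smul_smul, Nat.factorial_succ]
  congr 1
  have h1 : ((d : ℂ) + 1) ≠ 0 := Nat.cast_add_one_ne_zero d
  push_cast
  field_simp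

/-- The chain rule for the exponential of a power series without constant term. -/
theorem pderiv_exp_subst {τ : Type} {u : MvPowerSeries τ ℂ}
    (hu : MvPowerSeries.constantCoeff u = 0) (a : τ) :
    MvPowerSeries.pderiv ℂ a ((PowerSeries.exp ℂ).subst u) =
      (PowerSeries.exp ℂ).subst u * MvPowerSeries.pderiv ℂ a u := by
  classical
  ext e
  rw [MvPowerSeries.coeff_pderiv, coeff_exp_subst hu (N := e.degree + 1 + 1) (by simp),
    ← MvPowerSeries.coeff_pderiv, pderiv_expTrunc, MvPowerSeries.coeff_mul,
    MvPowerSeries.coeff_mul]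
  refine Finset.sum_congr rfl fun q hq => ?_
  rw [coeff_exp_subst hu (N := e.degree + 1)]
  rw [← Finset.HasAntidiagonal.mem_antidiagonal.1 hq, map_add]
  omega

theorem pderiv_gaussianSeries {n : ℕ} (μ : Fin n → ℂ) {σ : Matrix (Fin n) (Fin n) ℂ}
    (hσ : σ.IsSymm) (a : Fin n) :
    MvPowerSeries.pderiv ℂ a (gaussianSeries μ σ) =
      gaussianSeries μ σ * (MvPowerSeries.C (μ a) +
        ∑ b, MvPowerSeries.C (σ a b) * MvPowerSeries.X b) := by
  classical
  have hX : ∀ b, MvPowerSeries.pderiv ℂ a (MvPowerSeries.X b : MvPowerSeries (Fin n) ℂ) =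
      if b = a then 1 else 0 := by
    intro b
    rw [MvPowerSeries.pderiv_X, Pi.single_apply]
  have h1 : MvPowerSeries.pderiv ℂ a
      (∑ i, MvPowerSeries.C (μ i) * MvPowerSeries.X i : MvPowerSeries (Fin n) ℂ) =
      MvPowerSeries.C (μ a) := by
    simp [Derivation.leibniz, hX]
  have h2 : MvPowerSeries.pderiv ℂ a (MvPowerSeries.C (1 / 2 : ℂ) *
      ∑ i, ∑ j, MvPowerSeries.C (σ i j) * MvPowerSeries.X i * MvPowerSeries.X j :
        MvPowerSeries (Fin n) ℂ) = ∑ b, MvPowerSeries.C (σ a b) * MvPowerSeries.X b := by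
    have hs : ∀ b, σ b a = σ a b := fun b => hσ.apply a b
    have h3 : MvPowerSeries.pderiv ℂ a
      (∑ i, ∑ j, MvPowerSeries.C (σ i j) * MvPowerSeries.X i * MvPowerSeries.X j :
        MvPowerSeries (Fin n) ℂ) = ∑ b, MvPowerSeries.C (σ a b) * MvPowerSeries.X b +
          ∑ b, MvPowerSeries.C (σ a b) * MvPowerSeries.X b := by
      simp only [map_sum, Derivation.leibniz, hX, MvPowerSeries.pderiv_C, smul_eq_mul, mul_zero,
        add_zero, mul_ite, mul_one, Finset.sum_add_distrib, Finset.sum_ite_eq',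
        Finset.mem_univ, if_true]
      congr 1
      · exact Finset.sum_congr rfl fun b _ => by rw [hs]
      · rw [Finset.sum_comm]
        simp [mul_comm]
    rw [Derivation.leibniz, MvPowerSeries.pderiv_C, smul_zero, add_zero, h3, smul_eq_mul,
      ← two_mul, ← mul_assoc]
    have : (MvPowerSeries.C (1 / 2 : ℂ) * 2 : MvPowerSeries (Fin n) ℂ) = 1 := by
      rw [← map_ofNat (MvPowerSeries.C (σ := Fin n) (R := ℂ)) 2, ← map_mul]
      norm_num
    rw [this, one_mul]
  rw [gaussianSeries, Derivation.leibniz, pderiv_exp_subst (by simp),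
    pderiv_exp_subst (by simp), h1, h2, smul_eq_mul, smul_eq_mul]
  ring

/-- Scaling by the factorials of the exponent turns coefficients into iterated derivatives at the
origin: raising the exponent by one in the variable `a` amounts to a differentiation. -/
theorem factorial_mul_coeff_add_single {n : ℕ} (f : MvPowerSeries (Fin n) ℂ) (i : Fin n →₀ ℕ)
    (a : Fin n) :
    ((∏ j, ((i + Finsupp.single a 1 : Fin n →₀ ℕ) j).factorial : ℕ) : ℂ) *
        MvPowerSeries.coeff (i + Finsupp.single a 1) f =
      ((∏ j, (i j).factorial : ℕ) : ℂ) * MvPowerSeries.coeff i (MvPowerSeries.pderiv ℂ a f) := by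
  classical
  have h : ∏ j, ((i + Finsupp.single a 1 : Fin n →₀ ℕ) j).factorial =
      (i a + 1) * ∏ j, (i j).factorial := by
    rw [← Finset.mul_prod_erase _ _ (Finset.mem_univ a),
      ← Finset.mul_prod_erase _ (fun j => (i j).factorial) (Finset.mem_univ a)]
    have h2 : ∀ j ∈ Finset.univ.erase a,
        ((i + Finsupp.single a 1 : Fin n →₀ ℕ) j).factorial = (i j).factorial := by
      intro j hj
      simp [(Finset.ne_of_mem_erase hj).symm]
    rw [Finset.prod_congr rfl h2]
    simp [Nat.factorial_succ, mul_assoc]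
  rw [h, MvPowerSeries.coeff_pderiv]
  push_cast
  ring

section Moments

variable {R : Type} [CommRing R] {n k : ℕ}

/-- The moments of order one of a mixture, over any commutative ring. -/
def meanMoment (w : Fin k → R) (μ : Fin k → Fin n → R) (a : Fin n) : R := ∑ l, w l * μ l a

/-- The moments of order two of a mixture, over any commutative ring. -/
def secondMoment (w : Fin k → R) (μ : Fin k → Fin n → R) (σ : Fin k → Fin n → Fin n → R)
    (a b : Fin n) : R := ∑ l, w l * (μ l a * μ l b + σ l a b)

/-- The moments of order three of a mixture, over any commutative ring. -/
def thirdMoment (w : Fin k → R) (μ : Fin k → Fin n → R) (σ : Fin k → Fin n → Fin n → R)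
    (a b c : Fin n) : R :=
  ∑ l, w l * (μ l a * μ l b * μ l c + μ l a * σ l b c + μ l b * σ l a c + μ l c * σ l a b)

end Moments

variable {n k : ℕ}

theorem mixtureMoment_eq_sum (w : Fin k → ℂ) (μ : Fin k → Fin n → ℂ)
    (σ : Fin k → Matrix (Fin n) (Fin n) ℂ) (i : Fin n →₀ ℕ) :
    mixtureMoment w μ σ i = ∑ l, w l * (((∏ j, (i j).factorial : ℕ) : ℂ) *
      MvPowerSeries.coeff i (gaussianSeries (μ l) (σ l))) := by
  rw [mixtureMoment, map_sum, Finset.mul_sum]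
  refine Finset.sum_congr rfl fun l _ => ?_
  rw [MvPowerSeries.coeff_C_mul]
  ring

theorem mixtureMoment_single (w : Fin k → ℂ) (μ : Fin k → Fin n → ℂ)
    {σ : Fin k → Matrix (Fin n) (Fin n) ℂ} (hσ : ∀ l, (σ l).IsSymm) (a : Fin n) :
    mixtureMoment w μ σ (Finsupp.single a 1) = meanMoment w μ a := by
  rw [mixtureMoment_eq_sum, meanMoment]
  refine Finset.sum_congr rfl fun l _ => ?_
  rw [← zero_add (Finsupp.single a 1), factorial_mul_coeff_add_single,
    pderiv_gaussianSeries _ (hσ l)]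
  simp [constantCoeff_gaussianSeries]

theorem mixtureMoment_pair (w : Fin k → ℂ) (μ : Fin k → Fin n → ℂ)
    {σ : Fin k → Matrix (Fin n) (Fin n) ℂ} (hσ : ∀ l, (σ l).IsSymm) (a b : Fin n) :
    mixtureMoment w μ σ (Finsupp.single a 1 + Finsupp.single b 1) =
      secondMoment w μ (fun l a b => σ l a b) a b := by
  classical
  rw [mixtureMoment_eq_sum]
  refine Finset.sum_congr rfl fun l _ => ?_
  have hs : ∀ b, σ l b a = σ l a b := fun b => (hσ l).apply a b
  rw [← zero_add (Finsupp.single a 1), factorial_mul_coeff_add_single,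
    factorial_mul_coeff_add_single, pderiv_gaussianSeries _ (hσ l)]
  simp only [Derivation.leibniz, pderiv_gaussianSeries _ (hσ l)]
  simp [constantCoeff_gaussianSeries, MvPowerSeries.pderiv_X, Pi.single_apply, hs]
  left
  ring

theorem mixtureMoment_triple (w : Fin k → ℂ) (μ : Fin k → Fin n → ℂ)
    {σ : Fin k → Matrix (Fin n) (Fin n) ℂ} (hσ : ∀ l, (σ l).IsSymm) (a b c : Fin n) :
    mixtureMoment w μ σ (Finsupp.single a 1 + Finsupp.single b 1 + Finsupp.single c 1) =
      thirdMoment w μ (fun l a b => σ l a b) a b c := by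
  classical
  rw [mixtureMoment_eq_sum]
  refine Finset.sum_congr rfl fun l _ => ?_
  have hs : ∀ a b, σ l b a = σ l a b := fun a b => (hσ l).apply a b
  rw [← zero_add (Finsupp.single a 1), factorial_mul_coeff_add_single,
    factorial_mul_coeff_add_single, factorial_mul_coeff_add_single,
    pderiv_gaussianSeries _ (hσ l)]
  simp only [Derivation.leibniz, pderiv_gaussianSeries _ (hσ l), map_add, map_sum, smul_eq_mul]
  simp [constantCoeff_gaussianSeries, MvPowerSeries.pderiv_X, Pi.single_apply, apply_ite]
  rw [hs b a, hs c a, hs c b]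
  left
  ring

/-! ### Counting exponents -/

/-- The exponents of order at most three, except those of order three that involve only the last
`m` of the `r + m` variables. -/
def freeExponents (r m : ℕ) : Finset (Fin (r + m) →₀ ℕ) :=
  Finset.univ.finsuppAntidiag 0 ∪ Finset.univ.finsuppAntidiag 1 ∪
    Finset.univ.finsuppAntidiag 2 ∪ (Finset.univ.finsuppAntidiag 3 \
      (Finset.univ.map (Fin.natAddEmb r)).finsuppAntidiag 3)

theorem mem_finsuppAntidiag_univ {n d : ℕ} {i : Fin n →₀ ℕ} :
    i ∈ (Finset.univ : Finset (Fin n)).finsuppAntidiag d ↔ i.degree = d := by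
  rw [Finset.mem_finsuppAntidiag, Finsupp.degree_eq_sum]
  simp

theorem mem_freeExponents_of_degree_lt {r m : ℕ} {i : Fin (r + m) →₀ ℕ} (h : i.degree < 3) :
    i ∈ freeExponents r m := by
  simp only [freeExponents, Finset.mem_union, mem_finsuppAntidiag_univ]
  omega

theorem mem_freeExponents_of_apply_ne_zero {r m : ℕ} {i : Fin (r + m) →₀ ℕ} (h : i.degree = 3)
    {a : Fin r} (ha : i (Fin.castAdd m a) ≠ 0) : i ∈ freeExponents r m := by
  simp only [freeExponents, Finset.mem_union, Finset.mem_sdiff, mem_finsuppAntidiag_univ]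
  refine Or.inr ⟨h, fun hcon => ?_⟩
  have := (Finset.mem_finsuppAntidiag.1 hcon).2 (Finsupp.mem_support_iff.2 ha)
  obtain ⟨b, -, hb⟩ := Finset.mem_map.1 this
  have h2 := congrArg Fin.val hb
  simp at h2
  have := a.2
  omega

theorem card_freeExponents_le (r m : ℕ) :
    (freeExponents r m).card + (m + 2).choose 3 ≤
      1 + (r + m) + (r + m + 1).choose 2 + (r + m + 2).choose 3 := by
  have h1 : ∀ d, ((Finset.univ : Finset (Fin (r + m))).finsuppAntidiag d).card =
      (r + m + d - 1).choose d := fun d => by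
    rw [Finset.card_finsuppAntidiag_nat_eq_choose, Finset.card_univ, Fintype.card_fin]
  have h2 : ((Finset.univ.map (Fin.natAddEmb (m := m) r)).finsuppAntidiag 3).card =
      (m + 2).choose 3 := by
    rw [Finset.card_finsuppAntidiag_nat_eq_choose, Finset.card_map, Finset.card_univ,
      Fintype.card_fin]
    rfl
  have h3 := Finset.card_sdiff_add_card_eq_card (Finset.finsuppAntidiag_mono
    (Finset.subset_univ (Finset.univ.map (Fin.natAddEmb (m := m) r))) 3)
  rw [h1, h2] at h3
  have h4 : (freeExponents r m).card ≤ _ := Finset.card_union_le _ _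
  have h5 := Finset.card_union_le ((Finset.univ : Finset (Fin (r + m))).finsuppAntidiag 0 ∪
    Finset.univ.finsuppAntidiag 1) (Finset.univ.finsuppAntidiag 2)
  have h6 := Finset.card_union_le ((Finset.univ : Finset (Fin (r + m))).finsuppAntidiag 0)
    (Finset.univ.finsuppAntidiag 1)
  rw [h1 2] at h5
  rw [h1, h1, Nat.choose_zero_right, Nat.choose_one_right] at h6
  have e1 : r + m + 2 - 1 = r + m + 1 := rfl
  have e2 : r + m + 3 - 1 = r + m + 2 := rfl
  rw [e1] at h5
  rw [e2] at h3
  omega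

/-- Each linear form contributes at most its multiples by the quadratic monomials to the cubics that
vanish on a linear space of codimension `r`. -/
theorem choose_three_le (r m : ℕ) :
    (r + m + 2).choose 3 ≤ (m + 2).choose 3 + r * (r + m + 1).choose 2 := by
  induction r with
  | zero => simp
  | succ r ih =>
    have h1 : (r + 1 + m + 2).choose 3 = (r + m + 2).choose 2 + (r + m + 2).choose 3 := by
      rw [show r + 1 + m + 2 = (r + m + 2) + 1 by ring, Nat.choose_succ_succ']
    have h2 : (r + m + 1).choose 2 ≤ (r + m + 2).choose 2 := Nat.choose_le_choose _ (by omega)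
    have h3 := Nat.mul_le_mul_left r h2
    rw [show r + 1 + m + 1 = r + m + 2 by ring, add_mul, one_mul]
    omega

/-- The number of generators of the field of the generic point, compared with the expected
dimension. The term `(m + 2).choose 3` counts the moments that are not needed as generators. -/
theorem le_expectedDim {r m : ℕ} (hr : 1 ≤ r) (hm : 2 * r ≤ m) :
    1 + (r + m) + (r + m + 1).choose 2 + (r + m + 2).choose 3 + r * m ≤
      expectedDim (r + 1) (r + m) 3 + (m + 2).choose 3 := by
  -- This bound makes the count smaller than the ambient dimension.
  have h1 : 1 + r * m ≤ (m + 2).choose 3 := by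
    have h' : (m + 2).choose 3 * 6 = (m + 2) * (m + 1) * m := by
      have := Nat.descFactorial_eq_factorial_mul_choose (m + 2) 3
      simp [Nat.descFactorial_succ, Nat.factorial] at this
      rw [mul_comm, ← this]
      ring
    nlinarith [Nat.mul_le_mul_right m hm, Nat.zero_le (m * m * m)]
  have h2 : (r + m + 3).choose 3 =
      1 + (r + m) + (r + m + 1).choose 2 + (r + m + 2).choose 3 := by
    rw [Nat.choose_succ_succ' (r + m + 2) 2, Nat.choose_succ_succ' (r + m + 1) 1,
      Nat.choose_one_right]
    ring
  have h3 : (r + m) * (r + m + 3) / 2 = (r + m) + (r + m + 1).choose 2 := by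
    rw [Nat.choose_two_right, Nat.add_sub_cancel]
    have : (r + m) * (r + m + 3) = (r + m + 1) * (r + m) + (r + m) * 2 := by ring
    rw [this, Nat.add_mul_div_right _ _ (by norm_num), add_comm]
  -- This bound makes the count smaller than the number of parameters.
  have h4 := choose_three_le r m
  rw [expectedDim, h3, ← min_add_add_right, le_min_iff]
  constructor
  · omega
  · rw [add_mul, one_mul, mul_add r, mul_add r]
    omega

/-! ### Moments over an arbitrary ring -/

variable {R : Type} [CommRing R] {n k : ℕ}

/-- The moment attached to a list of indices, over any commutative ring; lists of more than three
indices get the value zero. -/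
def listMoment (w : Fin k → R) (μ : Fin k → Fin n → R) (σ : Fin k → Fin n → Fin n → R) :
    List (Fin n) → R
  | [] => ∑ l, w l
  | [a] => meanMoment w μ a
  | [a, b] => secondMoment w μ σ a b
  | [a, b, c] => thirdMoment w μ σ a b c
  | _ => 0

/-- The moment of a mixture with the given exponent, over any commutative ring, for exponents of
order at most three. The order in which the exponent is listed does not matter when the
covariance matrices are symmetric. -/
def moment (w : Fin k → R) (μ : Fin k → Fin n → R) (σ : Fin k → Fin n → Fin n → R)
    (i : Fin n →₀ ℕ) : R :=
  listMoment w μ σ (Finsupp.toMultiset i).toList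

theorem map_listMoment {S : Type} [CommRing S] (f : R →+* S) (w : Fin k → R)
    (μ : Fin k → Fin n → R) (σ : Fin k → Fin n → Fin n → R) (L : List (Fin n)) :
    f (listMoment w μ σ L) =
      listMoment (fun l => f (w l)) (fun l a => f (μ l a)) (fun l a b => f (σ l a b)) L := by
  match L with
  | [] | [a] | [a, b] | [a, b, c] =>
    simp [listMoment, meanMoment, secondMoment, thirdMoment]
  | _ :: _ :: _ :: _ :: _ => simp [listMoment]

theorem map_moment {S : Type} [CommRing S] (f : R →+* S) (w : Fin k → R)
    (μ : Fin k → Fin n → R) (σ : Fin k → Fin n → Fin n → R) (i : Fin n →₀ ℕ) :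
    f (moment w μ σ i) =
      moment (fun l => f (w l)) (fun l a => f (μ l a)) (fun l a b => f (σ l a b)) i :=
  map_listMoment f w μ σ _

variable (w : Fin k → R) (μ : Fin k → Fin n → R) {σ : Fin k → Fin n → Fin n → R}

theorem moment_zero (σ : Fin k → Fin n → Fin n → R) : moment w μ σ 0 = ∑ l, w l := by
  simp [moment, listMoment]

theorem moment_single (σ : Fin k → Fin n → Fin n → R) (a : Fin n) :
    moment w μ σ (Finsupp.single a 1) = meanMoment w μ a := by
  simp [moment, listMoment]

theorem secondMoment_comm (hσ : ∀ l a b, σ l a b = σ l b a) (a b : Fin n) :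
    secondMoment w μ σ a b = secondMoment w μ σ b a :=
  Finset.sum_congr rfl fun l _ => by rw [hσ l a b]; ring

theorem thirdMoment_swap_left (hσ : ∀ l a b, σ l a b = σ l b a) (a b c : Fin n) :
    thirdMoment w μ σ a b c = thirdMoment w μ σ b a c :=
  Finset.sum_congr rfl fun l _ => by rw [hσ l a b]; ring

theorem thirdMoment_swap_right (hσ : ∀ l a b, σ l a b = σ l b a) (a b c : Fin n) :
    thirdMoment w μ σ a b c = thirdMoment w μ σ a c b :=
  Finset.sum_congr rfl fun l _ => by rw [hσ l b c]; ring

/-- `Multiset.toList` picks an arbitrary order, so an exponent is known to give back a list of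
indices only up to permutation. -/
theorem toList_perm (L : List (Fin n)) :
    (Finsupp.toMultiset (L.map fun a => Finsupp.single a 1).sum).toList.Perm L := by
  rw [← Multiset.coe_eq_coe, Multiset.coe_toList]
  induction L with
  | nil => simp
  | cons a L ih => simp [ih]

theorem moment_pair (hσ : ∀ l a b, σ l a b = σ l b a) (a b : Fin n) :
    moment w μ σ (Finsupp.single a 1 + Finsupp.single b 1) = secondMoment w μ σ a b := by
  have h := List.mem_permutations.2 (toList_perm [a, b])
  simp only [List.map_cons, List.map_nil, List.sum_cons, List.sum_nil, add_zero] at h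
  rw [moment]
  revert h
  generalize Multiset.toList _ = L
  intro h
  simp [List.permutations, List.permutationsAux, List.permutationsAux.rec] at h
  rcases h with rfl | rfl
  · rfl
  · exact secondMoment_comm w μ hσ _ _

theorem moment_triple (hσ : ∀ l a b, σ l a b = σ l b a) (a b c : Fin n) :
    moment w μ σ (Finsupp.single a 1 + Finsupp.single b 1 + Finsupp.single c 1) =
      thirdMoment w μ σ a b c := by
  have h := List.mem_permutations.2 (toList_perm [a, b, c])
  simp only [List.map_cons, List.map_nil, List.sum_cons, List.sum_nil, add_zero,
    ← add_assoc] at h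
  rw [moment]
  revert h
  generalize Multiset.toList _ = L
  intro h
  simp [List.permutations, List.permutationsAux, List.permutationsAux.rec] at h
  have h1 := thirdMoment_swap_left w μ hσ
  have h2 := thirdMoment_swap_right w μ hσ
  rcases h with rfl | rfl | rfl | rfl | rfl | rfl <;> rw [listMoment] <;> grind

theorem eq_sum_single_of_degree_le {i : Fin n →₀ ℕ} (hi : i.degree ≤ 3) :
    i = 0 ∨ (∃ a, i = Finsupp.single a 1) ∨
      (∃ a b, i = Finsupp.single a 1 + Finsupp.single b 1) ∨
      ∃ a b c, i = Finsupp.single a 1 + Finsupp.single b 1 + Finsupp.single c 1 := by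
  have h1 : (Finsupp.toMultiset i).toList.length ≤ 3 := by
    rw [Multiset.length_toList, Finsupp.card_toMultiset]
    exact hi
  have h2 : i = ((Finsupp.toMultiset i).toList.map fun a => Finsupp.single a 1).sum := by
    have := Multiset.coe_eq_coe.2 (toList_perm (Finsupp.toMultiset i).toList)
    rw [Multiset.coe_toList, Multiset.coe_toList] at this
    have := congrArg Multiset.toFinsupp this.symm
    rwa [Finsupp.toMultiset_toFinsupp, Finsupp.toMultiset_toFinsupp] at this
  revert h1 h2
  generalize (Finsupp.toMultiset i).toList = L
  intro h1 h2
  match L, h1, h2 with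
  | [], _, h => exact Or.inl (by simpa using h)
  | [a], _, h => exact Or.inr (Or.inl ⟨a, by simpa using h⟩)
  | [a, b], _, h => exact Or.inr (Or.inr (Or.inl ⟨a, b, by simpa using h⟩))
  | [a, b, c], _, h =>
    exact Or.inr (Or.inr (Or.inr ⟨a, b, c, by simpa [add_assoc] using h⟩))
  | _ :: _ :: _ :: _ :: _, h, _ => simp at h; omega

theorem mixtureMoment_eq_moment (w : Fin k → ℂ) (μ : Fin k → Fin n → ℂ)
    {σ : Fin k → Matrix (Fin n) (Fin n) ℂ} (hσ : ∀ l, (σ l).IsSymm) {i : Fin n →₀ ℕ}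
    (hi : i.degree ≤ 3) :
    mixtureMoment w μ σ i = moment w μ (fun l a b => σ l a b) i := by
  have hσ' : ∀ l a b, σ l a b = σ l b a := fun l a b => (hσ l).apply b a
  rcases eq_sum_single_of_degree_le hi with rfl | ⟨a, rfl⟩ | ⟨a, b, rfl⟩ | ⟨a, b, c, rfl⟩
  · rw [mixtureMoment_zero, moment_zero]
  · rw [mixtureMoment_single _ _ hσ, moment_single]
  · rw [mixtureMoment_pair _ _ hσ, moment_pair _ _ hσ']
  · rw [mixtureMoment_triple _ _ hσ, moment_triple _ _ hσ']

/-! ### The third cumulant on the common kernel of the means -/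

section Kernel

variable {K : Type} [Field K] {n k : ℕ}

/-- The trilinear form with coefficients `T`. -/
def triForm (T : Fin n → Fin n → Fin n → K) (u v x : Fin n → K) : K :=
  ∑ a, ∑ b, ∑ c, u a * v b * x c * T a b c

/-- The bilinear form with coefficients `T`. -/
def biForm (T : Fin n → Fin n → K) (u v : Fin n → K) : K := ∑ a, ∑ b, u a * v b * T a b

theorem triForm_add_left (T : Fin n → Fin n → Fin n → K) (u u' v x : Fin n → K) :
    triForm T (u + u') v x = triForm T u v x + triForm T u' v x := by
  simp [triForm, add_mul, Finset.sum_add_distrib]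

theorem triForm_add_middle (T : Fin n → Fin n → Fin n → K) (u v v' x : Fin n → K) :
    triForm T u (v + v') x = triForm T u v x + triForm T u v' x := by
  simp [triForm, add_mul, mul_add, Finset.sum_add_distrib]

theorem triForm_add_right (T : Fin n → Fin n → Fin n → K) (u v x x' : Fin n → K) :
    triForm T u v (x + x') = triForm T u v x + triForm T u v x' := by
  simp [triForm, add_mul, mul_add, Finset.sum_add_distrib]

theorem triForm_single (T : Fin n → Fin n → Fin n → K) (a b c : Fin n) :
    triForm T (Pi.single a 1) (Pi.single b 1) (Pi.single c 1) = T a b c := by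
  simp [triForm, Pi.single_apply]

theorem triForm_gaussian (μ : Fin n → K) (σ : Fin n → Fin n → K) (u v x : Fin n → K) :
    triForm (fun a b c => μ a * μ b * μ c + μ a * σ b c + μ b * σ a c + μ c * σ a b) u v x =
      (u ⬝ᵥ μ) * (v ⬝ᵥ μ) * (x ⬝ᵥ μ) + (u ⬝ᵥ μ) * biForm σ v x + (v ⬝ᵥ μ) * biForm σ u x +
        (x ⬝ᵥ μ) * biForm σ u v := by
  simp only [triForm, mul_add, Finset.sum_add_distrib, biForm, dotProduct]
  congr 1
  · congr 1
    · congr 1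
      · rw [Finset.sum_mul_sum, Finset.sum_mul]
        refine Finset.sum_congr rfl fun a _ => ?_
        rw [Finset.sum_mul]
        refine Finset.sum_congr rfl fun b _ => ?_
        rw [Finset.mul_sum]
        exact Finset.sum_congr rfl fun c _ => by ring
      · rw [Finset.sum_mul]
        refine Finset.sum_congr rfl fun a _ => ?_
        rw [Finset.mul_sum]
        refine Finset.sum_congr rfl fun b _ => ?_
        rw [Finset.mul_sum]
        exact Finset.sum_congr rfl fun c _ => by ring
    · rw [Finset.sum_comm, Finset.sum_mul]
      refine Finset.sum_congr rfl fun a _ => ?_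
      rw [Finset.mul_sum]
      refine Finset.sum_congr rfl fun b _ => ?_
      rw [Finset.mul_sum]
      exact Finset.sum_congr rfl fun c _ => by ring
  · rw [Finset.mul_sum]
    refine Finset.sum_congr rfl fun a _ => ?_
    rw [Finset.mul_sum]
    refine Finset.sum_congr rfl fun b _ => ?_
    rw [Finset.sum_mul]
    exact Finset.sum_congr rfl fun c _ => by ring

theorem triForm_thirdMoment (w : Fin k → K) (μ : Fin k → Fin n → K)
    (σ : Fin k → Fin n → Fin n → K) (u v x : Fin n → K) :
    triForm (thirdMoment w μ σ) u v x = ∑ l, w l * triForm (fun a b c =>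
      μ l a * μ l b * μ l c + μ l a * σ l b c + μ l b * σ l a c + μ l c * σ l a b) u v x := by
  simp only [triForm, thirdMoment, Finset.mul_sum]
  symm
  rw [Finset.sum_comm]
  refine Finset.sum_congr rfl fun a _ => ?_
  rw [Finset.sum_comm]
  refine Finset.sum_congr rfl fun b _ => ?_
  rw [Finset.sum_comm]
  exact Finset.sum_congr rfl fun c _ => Finset.sum_congr rfl fun l _ => by ring

theorem biForm_secondMoment (w : Fin k → K) (μ : Fin k → Fin n → K)
    (σ : Fin k → Fin n → Fin n → K) (u v : Fin n → K) :
    biForm (secondMoment w μ σ) u v =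
      ∑ l, w l * ((u ⬝ᵥ μ l) * (v ⬝ᵥ μ l) + biForm (σ l) u v) := by
  have h : ∀ l, (u ⬝ᵥ μ l) * (v ⬝ᵥ μ l) + biForm (σ l) u v =
      ∑ a, ∑ b, u a * v b * (μ l a * μ l b + σ l a b) := by
    intro l
    simp only [mul_add, Finset.sum_add_distrib, biForm, dotProduct]
    rw [Finset.sum_mul_sum]
    congr 1
    exact Finset.sum_congr rfl fun a _ => Finset.sum_congr rfl fun b _ => by ring
  simp only [h]
  simp only [biForm, secondMoment, Finset.mul_sum]
  symm
  rw [Finset.sum_comm]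
  refine Finset.sum_congr rfl fun a _ => ?_
  rw [Finset.sum_comm]
  exact Finset.sum_congr rfl fun b _ => Finset.sum_congr rfl fun l _ => by ring

theorem dotProduct_meanMoment (w : Fin k → K) (μ : Fin k → Fin n → K) (u : Fin n → K) :
    u ⬝ᵥ meanMoment w μ = ∑ l, w l * (u ⬝ᵥ μ l) := by
  simp only [dotProduct, meanMoment, Finset.mul_sum]
  rw [Finset.sum_comm]
  exact Finset.sum_congr rfl fun l _ => Finset.sum_congr rfl fun a _ => by ring

/-- The third cumulant of a mixture vanishes on the vectors on which all means take the same
value. -/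
theorem triForm_thirdMoment_of_dotProduct_eq {w : Fin k → K} (hw : ∑ l, w l = 1)
    {μ : Fin k → Fin n → K} (σ : Fin k → Fin n → Fin n → K) {u v x : Fin n → K} {p q t : K}
    (hu : ∀ l, u ⬝ᵥ μ l = p) (hv : ∀ l, v ⬝ᵥ μ l = q) (hx : ∀ l, x ⬝ᵥ μ l = t) :
    triForm (thirdMoment w μ σ) u v x =
      (u ⬝ᵥ meanMoment w μ) * biForm (secondMoment w μ σ) v x +
      (v ⬝ᵥ meanMoment w μ) * biForm (secondMoment w μ σ) u x +
      (x ⬝ᵥ meanMoment w μ) * biForm (secondMoment w μ σ) u v -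
      2 * (u ⬝ᵥ meanMoment w μ) * (v ⬝ᵥ meanMoment w μ) * (x ⬝ᵥ meanMoment w μ) := by
  simp only [triForm_thirdMoment, triForm_gaussian, biForm_secondMoment, dotProduct_meanMoment,
    hu, hv, hx, mul_add, Finset.sum_add_distrib, ← Finset.sum_mul, hw, one_mul]
  have h : ∀ (c : K) (f : Fin k → K), ∑ l, w l * (c * f l) = c * ∑ l, w l * f l := fun c f => by
    rw [Finset.mul_sum]
    exact Finset.sum_congr rfl fun l _ => by ring
  simp only [h]
  ring

/-- The vector `∑ i, A i j e_i`, in the first `r` coordinates. -/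
def headVec {r m : ℕ} (A : Fin r → Fin m → K) (j : Fin m) : Fin (r + m) → K :=
  Fin.addCases (fun i => A i j) fun _ => 0

theorem headVec_castAdd {r m : ℕ} (A : Fin r → Fin m → K) (j : Fin m) (i : Fin r) :
    headVec A j (Fin.castAdd m i) = A i j :=
  Fin.addCases_left _

theorem headVec_natAdd {r m : ℕ} (A : Fin r → Fin m → K) (j i : Fin m) :
    headVec A j (Fin.natAdd r i) = 0 :=
  Fin.addCases_right _

/-- If the linear space on which all means take the same value is the graph of a matrix `A`, then
the moments of order three that involve only the last `m` variables can be computed from the other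
moments and from the entries of `A`. -/
theorem thirdMoment_natAdd_mem [Algebra ℂ K] (F : IntermediateField ℂ K) {r m : ℕ}
    {w : Fin k → K} (hw : ∑ l, w l = 1) {μ : Fin k → Fin (r + m) → K}
    {σ : Fin k → Fin (r + m) → Fin (r + m) → K} (hσ : ∀ l a b, σ l a b = σ l b a)
    {A : Fin r → Fin m → K} (hA : ∀ i j, A i j ∈ F) {p : Fin m → K}
    (hker : ∀ l j, (Pi.single (Fin.natAdd r j) 1 + headVec A j) ⬝ᵥ μ l = p j)
    (h1 : ∀ a, meanMoment w μ a ∈ F) (h2 : ∀ a b, secondMoment w μ σ a b ∈ F)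
    (h3 : ∀ i b c, thirdMoment w μ σ (Fin.castAdd m i) b c ∈ F) (a b c : Fin m) :
    thirdMoment w μ σ (Fin.natAdd r a) (Fin.natAdd r b) (Fin.natAdd r c) ∈ F := by
  let e : Fin m → Fin (r + m) → K := fun j => Pi.single (Fin.natAdd r j) 1
  let u : Fin m → Fin (r + m) → K := fun j => e j + headVec A j
  have he : ∀ j a, e j a ∈ F := fun j a => by
    by_cases h : a = Fin.natAdd r j
    · simp only [e, h, Pi.single_eq_same]; exact one_mem F
    · simp only [e, Pi.single_eq_of_ne h]; exact zero_mem F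
  have hd : ∀ j a, headVec A j a ∈ F := fun j a => by
    refine Fin.addCases (fun i => ?_) (fun i => ?_) a
    · rw [headVec_castAdd]; exact hA i j
    · rw [headVec_natAdd]; exact zero_mem F
  have hu : ∀ j a, u j a ∈ F := fun j a => add_mem (he j a) (hd j a)
  have hmean : ∀ j, u j ⬝ᵥ meanMoment w μ ∈ F := fun j =>
    sum_mem fun a _ => mul_mem (hu j a) (h1 a)
  have hbi : ∀ j j', biForm (secondMoment w μ σ) (u j) (u j') ∈ F := fun j j' =>
    sum_mem fun a _ => sum_mem fun b _ => mul_mem (mul_mem (hu j a) (hu j' b)) (h2 a b)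
  have htri : triForm (thirdMoment w μ σ) (u a) (u b) (u c) ∈ F := by
    rw [triForm_thirdMoment_of_dotProduct_eq hw σ (fun l => hker l a) (fun l => hker l b)
      (fun l => hker l c)]
    exact sub_mem (add_mem (add_mem (mul_mem (hmean a) (hbi b c)) (mul_mem (hmean b) (hbi a c)))
      (mul_mem (hmean c) (hbi a b)))
      (mul_mem (mul_mem (mul_mem (ofNat_mem F 2) (hmean a)) (hmean b)) (hmean c))
  have hleft : triForm (thirdMoment w μ σ) (headVec A a) (u b) (u c) ∈ F :=
    sum_mem fun x _ => sum_mem fun y _ => sum_mem fun z _ => by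
      refine Fin.addCases (fun i => ?_) (fun i => ?_) x
      · exact mul_mem (mul_mem (mul_mem (hd a _) (hu b y)) (hu c z)) (h3 i y z)
      · rw [headVec_natAdd, zero_mul, zero_mul, zero_mul]; exact zero_mem F
  have hmid : triForm (thirdMoment w μ σ) (e a) (headVec A b) (u c) ∈ F :=
    sum_mem fun x _ => sum_mem fun y _ => sum_mem fun z _ => by
      refine Fin.addCases (fun i => ?_) (fun i => ?_) y
      · rw [thirdMoment_swap_left w μ hσ]
        exact mul_mem (mul_mem (mul_mem (he a x) (hd b _)) (hu c z)) (h3 i x z)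
      · rw [headVec_natAdd, mul_zero, zero_mul, zero_mul]; exact zero_mem F
  have hright : triForm (thirdMoment w μ σ) (e a) (e b) (headVec A c) ∈ F :=
    sum_mem fun x _ => sum_mem fun y _ => sum_mem fun z _ => by
      refine Fin.addCases (fun i => ?_) (fun i => ?_) z
      · rw [thirdMoment_swap_right w μ hσ, thirdMoment_swap_left w μ hσ]
        exact mul_mem (mul_mem (mul_mem (he a x) (he b y)) (hd c _)) (h3 i x y)
      · rw [headVec_natAdd, mul_zero, zero_mul]; exact zero_mem F
  rw [← triForm_single (thirdMoment w μ σ)]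
  -- Expand the trilinear form slot by slot, with `e j = u j - headVec A j`.
  have key : triForm (thirdMoment w μ σ) (e a) (e b) (e c) =
      triForm (thirdMoment w μ σ) (u a) (u b) (u c) -
        triForm (thirdMoment w μ σ) (headVec A a) (u b) (u c) -
        triForm (thirdMoment w μ σ) (e a) (headVec A b) (u c) -
        triForm (thirdMoment w μ σ) (e a) (e b) (headVec A c) := by
    rw [triForm_add_left _ (e a), triForm_add_middle _ (e a) (e b),
      triForm_add_right _ (e a) (e b) (e c)]
    ring
  exact key ▸ sub_mem (sub_mem (sub_mem htri hleft) hmid) hright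

end Kernel

/-! ### The generic mixture -/

/-- The names of the parameters of the affine cone over the mixtures of `k` Gaussians: a scaling
factor, the weights, the means and the covariances. -/
abbrev Param (k n : ℕ) : Type := Option (Fin k ⊕ (Fin k × Fin n) ⊕ (Fin k × Fin n × Fin n))

/-- The ring of polynomials in the parameters. -/
abbrev ParamRing (k n : ℕ) : Type := MvPolynomial (Param k n) ℂ

/-- The generic weights. They are normalized by correcting the weight with index `0`. -/
def genericWeight (r n : ℕ) (l : Fin (r + 1)) : ParamRing (r + 1) n :=
  MvPolynomial.X (some (Sum.inl l)) +
    if l = 0 then 1 - ∑ l', MvPolynomial.X (some (Sum.inl l')) else 0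

/-- The generic means. -/
def genericMean (k n : ℕ) (l : Fin k) (a : Fin n) : ParamRing k n :=
  MvPolynomial.X (some (Sum.inr (Sum.inl (l, a))))

/-- The generic covariances, made symmetric by adding the transposed matrix. -/
def genericCov (k n : ℕ) (l : Fin k) (a b : Fin n) : ParamRing k n :=
  MvPolynomial.X (some (Sum.inr (Sum.inr (l, a, b)))) +
    MvPolynomial.X (some (Sum.inr (Sum.inr (l, b, a))))

theorem sum_genericWeight (r n : ℕ) : ∑ l, genericWeight r n l = 1 := by
  simp [genericWeight, Finset.sum_add_distrib]

theorem genericCov_symm (k n : ℕ) (l : Fin k) (a b : Fin n) :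
    genericCov k n l a b = genericCov k n l b a :=
  add_comm _ _

/-- A moment of the generic point of the affine cone over the mixtures. -/
def genericMoment (r n : ℕ) (i : Fin n →₀ ℕ) : ParamRing (r + 1) n :=
  MvPolynomial.X none *
    moment (genericWeight r n) (genericMean (r + 1) n) (genericCov (r + 1) n) i

/-- The polynomial relations between the generic moments hold on the cone over the mixtures. -/
theorem mem_vanishingIdeal_of_aeval_genericMoment {r n : ℕ}
    {f : MvPolynomial (MomentIndex n 3) ℂ}
    (hf : MvPolynomial.aeval (fun i : MomentIndex n 3 => genericMoment r n i.1) f = 0) :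
    f ∈ ProjSpace.vanishingIdeal (mixtureImage (r + 1) n 3) := by
  rintro v hv ⟨w, hw, μ, σ, hσ, h⟩
  obtain ⟨c, hc⟩ := (Projectivization.mk_eq_mk_iff' ℂ _ _ _ _).1 h
  let ρ : Param (r + 1) n → ℂ := fun x => match x with
    | none => c
    | some (Sum.inl l) => w l
    | some (Sum.inr (Sum.inl (l, a))) => μ l a
    -- `genericCov` adds the transposed matrix, hence the factor `1 / 2`.
    | some (Sum.inr (Sum.inr (l, a, b))) => σ l a b / 2
  have hρ : ∀ i : MomentIndex n 3, MvPolynomial.eval ρ (genericMoment r n i.1) = v i := by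
    intro i
    have e1 : ∀ l, MvPolynomial.eval ρ (genericWeight r n l) = w l := fun l => by
      by_cases hl : l = 0 <;> simp [genericWeight, hl, ρ, hw]
    have e2 : ∀ l a, MvPolynomial.eval ρ (genericMean (r + 1) n l a) = μ l a := fun l a => by
      simp [genericMean, ρ]
    have e3 : ∀ l a b, MvPolynomial.eval ρ (genericCov (r + 1) n l a b) = σ l a b :=
      fun l a b => by
        have := (hσ l).apply a b
        simp [genericCov, ρ, this]
    rw [genericMoment, map_mul, map_moment, ← hc]
    simp only [e1, e2, e3, MvPolynomial.eval_X]
    rw [Pi.smul_apply, momentVector, mixtureMoment_eq_moment w μ hσ i.2]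
    rfl
  have h2 := congrArg (MvPolynomial.aeval ρ) hf
  rw [map_zero, MvPolynomial.comp_aeval_apply] at h2
  have hρ' : (fun i : MomentIndex n 3 => MvPolynomial.aeval ρ (genericMoment r n i.1)) = v :=
    funext hρ
  rwa [hρ'] at h2

/-- The differences of the generic means, restricted to the first `r` coordinates, form a
nonsingular matrix. -/
theorem det_genericMean_sub_ne_zero (r m : ℕ) :
    (Matrix.of fun (l i : Fin r) => genericMean (r + 1) (r + m) l.succ (Fin.castAdd m i) -
      genericMean (r + 1) (r + m) 0 (Fin.castAdd m i)).det ≠ 0 := by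
  intro h
  -- Specialize the means to `0` and the first `r` unit vectors.
  let ρ : Param (r + 1) (r + m) → ℂ := fun x => match x with
    | some (Sum.inr (Sum.inl (l, a))) =>
      Fin.cases (motive := fun _ => ℂ) 0 (fun l' => if Fin.castAdd m l' = a then 1 else 0) l
    | _ => 0
  have h2 := congrArg (MvPolynomial.eval ρ) h
  rw [RingHom.map_det, map_zero] at h2
  have h3 : (MvPolynomial.eval ρ).mapMatrix (Matrix.of fun (l i : Fin r) =>
      genericMean (r + 1) (r + m) l.succ (Fin.castAdd m i) -
        genericMean (r + 1) (r + m) 0 (Fin.castAdd m i)) = 1 := by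
    ext l i
    simp [genericMean, ρ, Matrix.one_apply]
  rw [h3, Matrix.det_one] at h2
  exact one_ne_zero h2

/-- The linear space on which the generic means take the same value is the graph of a matrix. -/
theorem exists_graph_genericMean {K : Type} [Field K] {r m : ℕ}
    (f : ParamRing (r + 1) (r + m) →+* K) (hf : Function.Injective f) :
    ∃ (A : Fin r → Fin m → K) (p : Fin m → K), ∀ l j,
      (Pi.single (Fin.natAdd r j) 1 + headVec A j) ⬝ᵥ
        (fun a => f (genericMean (r + 1) (r + m) l a)) = p j := by
  let μ : Fin (r + 1) → Fin (r + m) → K := fun l a => f (genericMean (r + 1) (r + m) l a)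
  let V : Matrix (Fin r) (Fin r) K :=
    Matrix.of fun l i => μ l.succ (Fin.castAdd m i) - μ 0 (Fin.castAdd m i)
  let U : Matrix (Fin r) (Fin m) K :=
    Matrix.of fun l j => μ l.succ (Fin.natAdd r j) - μ 0 (Fin.natAdd r j)
  have hV : IsUnit V.det := by
    refine isUnit_iff_ne_zero.2 fun h => det_genericMean_sub_ne_zero r m (hf ?_)
    rw [map_zero, ← h, RingHom.map_det]
    congr 1
    ext l i
    simp [V, μ]
  let A : Fin r → Fin m → K := fun i j => (-(V⁻¹ * U)) i j
  have hVA : V * Matrix.of A = -U := by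
    change V * -(V⁻¹ * U) = -U
    rw [Matrix.mul_neg, ← Matrix.mul_assoc, Matrix.mul_nonsing_inv _ hV, Matrix.one_mul]
  have hdot : ∀ l j, (Pi.single (Fin.natAdd r j) 1 + headVec A j) ⬝ᵥ μ l =
      μ l (Fin.natAdd r j) + ∑ i, A i j * μ l (Fin.castAdd m i) := by
    intro l j
    rw [add_dotProduct, single_one_dotProduct, dotProduct, Fin.sum_univ_add]
    simp only [headVec_castAdd, headVec_natAdd, zero_mul, Finset.sum_const_zero, add_zero]
  refine ⟨A, fun j => μ 0 (Fin.natAdd r j) + ∑ i, A i j * μ 0 (Fin.castAdd m i), fun l j => ?_⟩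
  refine (hdot l j).trans ?_
  refine Fin.cases rfl (fun l' => ?_) l
  have h := congrFun (congrFun hVA l') j
  have h2 : ∑ i, (μ l'.succ (Fin.castAdd m i) - μ 0 (Fin.castAdd m i)) * A i j =
      -(μ l'.succ (Fin.natAdd r j) - μ 0 (Fin.natAdd r j)) := h
  have h3 : ∑ i, (μ l'.succ (Fin.castAdd m i) - μ 0 (Fin.castAdd m i)) * A i j =
      ∑ i, A i j * μ l'.succ (Fin.castAdd m i) - ∑ i, A i j * μ 0 (Fin.castAdd m i) := by
    rw [← Finset.sum_sub_distrib]
    exact Finset.sum_congr rfl fun i _ => by ring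
  linear_combination h2 - h3

/-- The coordinates of the generic point of the affine cone over the mixtures of `r + 1` Gaussians
in `r + m` variables lie in a field generated by the moments with exponents in `freeExponents r m`
and by `r * m` further elements. -/
theorem exists_generators_genericMoment {K : Type} [Field K] [Algebra ℂ K] {r m : ℕ}
    (f : ParamRing (r + 1) (r + m) →+* K) (hf : Function.Injective f) :
    ∃ S : Finset K, S.card ≤ (freeExponents r m).card + r * m ∧
      ∀ i : Fin (r + m) →₀ ℕ, i.degree ≤ 3 →
        f (genericMoment r (r + m) i) ∈ IntermediateField.adjoin ℂ (S : Set K) := by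
  classical
  obtain ⟨A, p, hA⟩ := exists_graph_genericMean f hf
  let g : (Fin (r + m) →₀ ℕ) → K := fun i => f (genericMoment r (r + m) i)
  let S : Finset K := (freeExponents r m).image g ∪
    Finset.univ.image fun x : Fin r × Fin m => A x.1 x.2
  refine ⟨S, ?_, ?_⟩
  · refine (Finset.card_union_le _ _).trans (add_le_add Finset.card_image_le ?_)
    refine Finset.card_image_le.trans ?_
    simp
  let F := IntermediateField.adjoin ℂ (S : Set K)
  have hSF : ∀ x ∈ S, x ∈ F := fun x hx => IntermediateField.subset_adjoin _ _ hx
  have hAF : ∀ i j, A i j ∈ F := fun i j => hSF _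
    (Finset.mem_union_right _ (Finset.mem_image.2 ⟨(i, j), Finset.mem_univ _, rfl⟩))
  have hgF : ∀ i ∈ freeExponents r m, g i ∈ F := fun i hi => hSF _
    (Finset.mem_union_left _ (Finset.mem_image_of_mem _ hi))
  let w : Fin (r + 1) → K := fun l => f (genericWeight r (r + m) l)
  let μ : Fin (r + 1) → Fin (r + m) → K := fun l a => f (genericMean (r + 1) (r + m) l a)
  let σ : Fin (r + 1) → Fin (r + m) → Fin (r + m) → K :=
    fun l a b => f (genericCov (r + 1) (r + m) l a b)
  have hσ : ∀ l a b, σ l a b = σ l b a := fun l a b =>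
    congrArg f (genericCov_symm _ _ l a b)
  have hw : ∑ l, w l = 1 := by
    rw [← map_sum, sum_genericWeight, map_one]
  let s : K := f (MvPolynomial.X none)
  have hs : s ≠ 0 := (map_ne_zero_iff f hf).2 (MvPolynomial.X_ne_zero _)
  have hg : ∀ i, g i = s * moment w μ σ i := fun i => by
    simp only [g, genericMoment, map_mul, map_moment]
    rfl
  -- The moment of order zero is the scaling factor.
  have hsF : s ∈ F := by
    have := hgF 0 (mem_freeExponents_of_degree_lt (by simp))
    rwa [hg, moment_zero, hw, mul_one] at this
  have hmF : ∀ i ∈ freeExponents r m, moment w μ σ i ∈ F := fun i hi => by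
    have := div_mem (hgF i hi) hsF
    rwa [hg, mul_div_cancel_left₀ _ hs] at this
  have h1 : ∀ a, meanMoment w μ a ∈ F := fun a => by
    rw [← moment_single w μ σ]
    exact hmF _ (mem_freeExponents_of_degree_lt (by simp))
  have h2 : ∀ a b, secondMoment w μ σ a b ∈ F := fun a b => by
    rw [← moment_pair w μ hσ]
    exact hmF _ (mem_freeExponents_of_degree_lt (by simp))
  have h3 : ∀ i b c, thirdMoment w μ σ (Fin.castAdd m i) b c ∈ F := fun i b c => by
    rw [← moment_triple w μ hσ]
    exact hmF _ (mem_freeExponents_of_apply_ne_zero (a := i) (by simp) (by simp))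
  intro i hi
  change g i ∈ F
  rw [hg]
  refine mul_mem hsF ?_
  rcases eq_sum_single_of_degree_le hi with rfl | ⟨a, rfl⟩ | ⟨a, b, rfl⟩ | ⟨a, b, c, rfl⟩
  · rw [moment_zero, hw]
    exact one_mem F
  · rw [moment_single]
    exact h1 a
  · rw [moment_pair w μ hσ]
    exact h2 a b
  · rw [moment_triple w μ hσ]
    refine Fin.addCases (fun a => h3 a b c) (fun a => ?_) a
    refine Fin.addCases (fun b => ?_) (fun b => ?_) b
    · rw [thirdMoment_swap_left w μ hσ]
      exact h3 _ _ _
    refine Fin.addCases (fun c => ?_) (fun c => ?_) c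
    · rw [thirdMoment_swap_right w μ hσ, thirdMoment_swap_left w μ hσ]
      exact h3 _ _ _
    · exact thirdMoment_natAdd_mem F hw hσ hAF hA h1 h2 h3 a b c

/-! ### Defectivity -/

theorem mixtureImage_nonempty (r n d : ℕ) : (mixtureImage (r + 1) n d).Nonempty :=
  ⟨_, Pi.single 0 1, by simp, 0, 0, fun _ => Matrix.isSymm_zero, rfl⟩

instance finite_momentIndex (n d : ℕ) : Finite (MomentIndex n d) := by
  have h : {i : Fin n →₀ ℕ | i.degree ≤ d}.Finite := by
    refine ((Finset.range (d + 1)).biUnion fun e =>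
      (Finset.univ : Finset (Fin n)).finsuppAntidiag e).finite_toSet.subset fun i hi => ?_
    have hi : i.degree ≤ d := hi
    rw [Finset.mem_coe, Finset.mem_biUnion]
    exact ⟨i.degree, by rw [Finset.mem_range]; omega, mem_finsuppAntidiag_univ.2 rfl⟩
  exact h.to_subtype

/-- Defectivity in terms of `r = k - 1` and of the dimension `m` of the linear space on which
generic means take the same value. -/
theorem isDefective_of_two_mul_le {r m : ℕ} (hr : 1 ≤ r) (hm : 2 * r ≤ m) :
    IsDefective (r + 1) (r + m) 3 := by
  let K := FractionRing (ParamRing (r + 1) (r + m))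
  let f : ParamRing (r + 1) (r + m) →ₐ[ℂ] K := IsScalarTower.toAlgHom ℂ _ K
  have hf : Function.Injective f := IsFractionRing.injective (ParamRing (r + 1) (r + m)) K
  obtain ⟨S, hScard, hS⟩ := exists_generators_genericMoment f.toRingHom hf
  have h1 := card_freeExponents_le r m
  have h2 := le_expectedDim hr hm
  obtain ⟨p, hp⟩ : ∃ p, expectedDim (r + 1) (r + m) 3 = p + 1 := by
    refine Nat.exists_eq_succ_of_ne_zero fun h0 => ?_
    have := Finset.card_pos.2 ⟨0, mem_freeExponents_of_degree_lt (r := r) (m := m) (i := 0)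
      (by simp)⟩
    omega
  have hdim := ProjSpace.dim_closure_le (mixtureImage_nonempty r (r + m) 3)
    (fun i : MomentIndex (r + m) 3 => f (genericMoment r (r + m) i.1)) (fun q hq => ?_) S
    (fun i => hS i.1 i.2) (p := p) (by omega)
  · rw [IsDefective, Sec, hp]
    refine hdim.trans_lt ?_
    exact_mod_cast Nat.lt_succ_self p
  · refine mem_vanishingIdeal_of_aeval_genericMoment (hf ?_)
    rw [map_zero, MvPolynomial.comp_aeval_apply]
    exact hq

end GaussianMoments

end

theorem corollary3p5 (k n : ℕ) (hk : 2 ≤ k) (hn : 3 * k - 3 ≤ n) :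
    GaussianMoments.IsDefective k n 3 := by
  obtain ⟨r, rfl⟩ : ∃ r, k = r + 1 := ⟨k - 1, by omega⟩
  obtain ⟨m, rfl⟩ : ∃ m, n = r + m := ⟨n - r, by omega⟩
  exact GaussianMoments.isDefective_of_two_mul_le (by omega) (by omega)
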